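/- Let $d\ge 1$ and let $D\subset\mathbb{R}^d$ be a bounded open set. Let $X=C^0(D;\mathbb{R}^N)$ be the space of bounded continuous functions $D\to\mathbb{R}^N$ with norm $\|u\|_X=\sup_{x\in D}|u(x)|$. Let $\Lambda\subseteq\mathbb{R}^k$ and let $A_1,\dots,A_N$ be maps from $\Lambda$ to the Borel subsets of $D$ such that, for every $a\in\Lambda$, the sets $A_1(a),\dots,A_N(a)$ are pairwise disjoint with union $D$, and such that for each $i$ and $a\in\Lambda$ the Lebesgue measure $|A_i(a)\,\Delta\,A_i(b)|$ tends to $0$ as $b\to a$ in $\Lambda$. For $u=(u_1,\dots,u_N)\in X$ and $a\in\Lambda$ put $$u^a=\sum_{i=1}^N u_i\,\mathbf 1_{A_i(a)}\in L^\infty(D).$$ Let $\sigma:\mathbb{R}\to(0,\infty)$ be continuously differentiable. Let $V=H^1(D)$, let $H^1_0(D)$ be the closure of $C_c^\infty(D)$ in $V$, let $f\in H^{-1}(D)=H^1_0(D)^*$, and let $g\in H^{1/2}(\partial D)$, where $H^{1/2}(\partial D)$ denotes the space of traces of $V$, that is, $V/H^1_0(D)$, with trace map $\mathrm{tr}$ the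 quotient map. (For a bounded Lipschitz domain this is the usual $H^{1/2}(\partial D)$, via the usual trace operator, whose kernel is $H_0^1(D)$.) Then for all $u\in X$ and $a\in\Lambda$ there is exactly one weak solution $p_{u,a}\in V$ of $$-\nabla\cdot\big(\sigma(u^a)\nabla p_{u,a}\big)=f\ \text{ in } D,\qquad p_{u,a}=g\ \text{ on }\partial D,$$ that is, exactly one $p_{u,a}\in V$ with $\mathrm{tr}(p_{u,a})=g$ and $\int_D\sigma(u^a)\nabla p_{u,a}\cdot\nabla\varphi\,dx=f(\varphi)$ for all $\varphi\in H^1_0(D)$. Write $\mathcal R(u,a)=p_{u,a}$, let $\ell:V\to\mathbb{R}^J$ be continuous and linear, and let $\mathcal G=\ell\circ\mathcal R:X\times\Lambda\to\mathbb{R}^J$. Then: 1. For every $r>0$ there is $C(r)>0$ such that for all $u,v\in X$ with $\|u\|_X,\|v\|_X<r$ and all $a\in\Lambda$, $$|\mathcal G(u,a)-\mathcal G(v,a)|\le C(r)\,\|u-v\|_X.$$ 2. For each $u\in X$, the map $\mathcal G(u,\cdot):\Lambda\to\mathbb{R}^J$ is continuous. -/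

import Mathlib

open MeasureTheory TopologicalSpace Filter Topology Distributions
open scoped BoundedContinuousFunction

namespace Darcy

/-- `w` is the weak gradient of `v` on the open set `D`: for every test function `φ ∈ C_c^∞(D)`
and every coordinate `i`, `∫_D v ∂ᵢφ = - ∫_D wᵢ φ`. -/
def HasWeakGradient {d : ℕ} (D : Opens (EuclideanSpace ℝ (Fin d)))
    (v : EuclideanSpace ℝ (Fin d) → ℝ)
    (w : EuclideanSpace ℝ (Fin d) → EuclideanSpace ℝ (Fin d)) : Prop :=
  ∀ (φ : 𝓓(D, ℝ)) (i : Fin d),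
    ∫ x in (D : Set (EuclideanSpace ℝ (Fin d))),
        v x * fderiv ℝ φ x (EuclideanSpace.single i 1) =
      -∫ x in (D : Set (EuclideanSpace ℝ (Fin d))), w x i * φ x

/-- The space `L²(D) × L²(D; ℝ^d)`, with the Hilbert norm `(‖v‖² + ‖w‖²)^{1/2}`. -/
abbrev L2Pair {d : ℕ} (D : Opens (EuclideanSpace ℝ (Fin d))) : Type :=
  WithLp 2
    (Lp ℝ 2 (volume.restrict (D : Set (EuclideanSpace ℝ (Fin d)))) ×
      Lp (EuclideanSpace ℝ (Fin d)) 2 (volume.restrict (D : Set (EuclideanSpace ℝ (Fin d)))))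

theorem integrable_mul_fderiv {d : ℕ} {D : Opens (EuclideanSpace ℝ (Fin d))}
    (v : Lp ℝ 2 (volume.restrict (D : Set (EuclideanSpace ℝ (Fin d)))))
    (φ : 𝓓(D, ℝ)) (e : EuclideanSpace ℝ (Fin d)) :
    Integrable (fun x => v x * fderiv ℝ φ x e)
      (volume.restrict (D : Set (EuclideanSpace ℝ (Fin d)))) := by
  have hc : Continuous (fun x => fderiv ℝ φ x e) :=
    (φ.contDiff.continuous_fderiv (by simp)).clm_apply continuous_const
  have hs : HasCompactSupport (fun x => fderiv ℝ φ x e) :=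
    φ.hasCompactSupport.fderiv_apply (𝕜 := ℝ) e
  exact (Lp.memLp v).integrable_mul (hc.memLp_of_hasCompactSupport (p := 2) hs)

theorem integrable_coord_mul {d : ℕ} {D : Opens (EuclideanSpace ℝ (Fin d))}
    (w : Lp (EuclideanSpace ℝ (Fin d)) 2
      (volume.restrict (D : Set (EuclideanSpace ℝ (Fin d)))))
    (φ : 𝓓(D, ℝ)) (i : Fin d) :
    Integrable (fun x => w x i * φ x)
      (volume.restrict (D : Set (EuclideanSpace ℝ (Fin d)))) := by
  have hw : MemLp (fun x => w x i) 2
      (volume.restrict (D : Set (EuclideanSpace ℝ (Fin d)))) :=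
    (EuclideanSpace.proj (𝕜 := ℝ) i).comp_memLp' (Lp.memLp w)
  exact hw.integrable_mul (φ.continuous.memLp_of_hasCompactSupport (p := 2) φ.hasCompactSupport)

/-- The Sobolev space `H¹(D)`, realised as the space of pairs `(v, ∇v)` with `v ∈ L²(D)` and
weak gradient `∇v ∈ L²(D; ℝ^d)`; the norm is `(‖v‖²_{L²} + ‖∇v‖²_{L²})^{1/2}`. -/
noncomputable def H1 {d : ℕ} (D : Opens (EuclideanSpace ℝ (Fin d))) :
    Submodule ℝ (L2Pair D) where
  carrier := {p | HasWeakGradient D p.fst p.snd}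
  zero_mem' := by
    intro φ i
    have h1 := Lp.coeFn_zero ℝ 2 (volume.restrict (D : Set (EuclideanSpace ℝ (Fin d))))
    have h2 := Lp.coeFn_zero (EuclideanSpace ℝ (Fin d)) 2
      (volume.restrict (D : Set (EuclideanSpace ℝ (Fin d))))
    rw [WithLp.zero_fst, WithLp.zero_snd, integral_eq_zero_of_ae, integral_eq_zero_of_ae, neg_zero]
    · filter_upwards [h2] with x hx
      rw [hx]
      simp
    · filter_upwards [h1] with x hx
      rw [hx]
      simp
  add_mem' := by
    intro p q hp hq φ i
    have h1 := Lp.coeFn_add p.fst q.fst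
    have h2 := Lp.coeFn_add p.snd q.snd
    rw [WithLp.add_fst, WithLp.add_snd]
    have e1 : (fun x => (p.fst + q.fst) x * fderiv ℝ φ x (EuclideanSpace.single i 1))
        =ᵐ[volume.restrict (D : Set (EuclideanSpace ℝ (Fin d)))]
        fun x => p.fst x * fderiv ℝ φ x (EuclideanSpace.single i 1)
          + q.fst x * fderiv ℝ φ x (EuclideanSpace.single i 1) := by
      filter_upwards [h1] with x hx
      rw [hx, Pi.add_apply, add_mul]
    have e2 : (fun x => (p.snd + q.snd) x i * φ x)
        =ᵐ[volume.restrict (D : Set (EuclideanSpace ℝ (Fin d)))]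
        fun x => p.snd x i * φ x + q.snd x i * φ x := by
      filter_upwards [h2] with x hx
      rw [hx, Pi.add_apply, PiLp.add_apply, add_mul]
    rw [integral_congr_ae e1, integral_congr_ae e2,
      integral_add (integrable_mul_fderiv _ _ _) (integrable_mul_fderiv _ _ _),
      integral_add (integrable_coord_mul _ _ _) (integrable_coord_mul _ _ _), hp φ i, hq φ i]
    ring
  smul_mem' := by
    intro c p hp φ i
    have h1 := Lp.coeFn_smul c p.fst
    have h2 := Lp.coeFn_smul c p.snd
    rw [WithLp.smul_fst, WithLp.smul_snd]
    have e1 : (fun x => (c • p.fst) x * fderiv ℝ φ x (EuclideanSpace.single i 1))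
        =ᵐ[volume.restrict (D : Set (EuclideanSpace ℝ (Fin d)))]
        fun x => c * (p.fst x * fderiv ℝ φ x (EuclideanSpace.single i 1)) := by
      filter_upwards [h1] with x hx
      rw [hx, Pi.smul_apply, smul_eq_mul, mul_assoc]
    have e2 : (fun x => (c • p.snd) x i * φ x)
        =ᵐ[volume.restrict (D : Set (EuclideanSpace ℝ (Fin d)))]
        fun x => c * (p.snd x i * φ x) := by
      filter_upwards [h2] with x hx
      rw [hx, Pi.smul_apply, PiLp.smul_apply, smul_eq_mul, mul_assoc]
    rw [integral_congr_ae e1, integral_congr_ae e2, integral_const_mul, integral_const_mul,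
      hp φ i, mul_neg]

/-- The underlying `L²(D)` function of an element of `H¹(D)`. -/
noncomputable def val {d : ℕ} {D : Opens (EuclideanSpace ℝ (Fin d))} (p : H1 D) :
    Lp ℝ 2 (volume.restrict (D : Set (EuclideanSpace ℝ (Fin d)))) :=
  (p : L2Pair D).fst

/-- The weak gradient of an element of `H¹(D)`. -/
noncomputable def grad {d : ℕ} {D : Opens (EuclideanSpace ℝ (Fin d))} (p : H1 D) :
    Lp (EuclideanSpace ℝ (Fin d)) 2 (volume.restrict (D : Set (EuclideanSpace ℝ (Fin d)))) :=
  (p : L2Pair D).snd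

/-- The subspace of `H¹(D)` consisting of (the classes of) the functions in `C_c^∞(D)`. -/
noncomputable def testSubspace {d : ℕ} (D : Opens (EuclideanSpace ℝ (Fin d))) :
    Submodule ℝ (H1 D) where
  carrier := {p | ∃ φ : 𝓓(D, ℝ),
    val p =ᵐ[volume.restrict (D : Set (EuclideanSpace ℝ (Fin d)))] φ}
  zero_mem' := ⟨0, Lp.coeFn_zero ℝ 2 _⟩
  add_mem' := by
    rintro p q ⟨φ, hφ⟩ ⟨ψ, hψ⟩
    refine ⟨φ + ψ, ?_⟩
    refine (Lp.coeFn_add (val p) (val q)).trans ?_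
    filter_upwards [hφ, hψ] with x h1 h2
    simp [h1, h2]
  smul_mem' := by
    rintro c p ⟨φ, hφ⟩
    refine ⟨c • φ, ?_⟩
    refine (Lp.coeFn_smul c (val p)).trans ?_
    filter_upwards [hφ] with x h1
    simp [h1]

/-- `H¹₀(D)`: the closure of `C_c^∞(D)` in `H¹(D)`. -/
noncomputable def H10 {d : ℕ} (D : Opens (EuclideanSpace ℝ (Fin d))) : Submodule ℝ (H1 D) :=
  (testSubspace D).topologicalClosure

/-- `H⁻¹(D)`: the continuous dual of `H¹₀(D)`. -/
abbrev HMinus1 {d : ℕ} (D : Opens (EuclideanSpace ℝ (Fin d))) : Type :=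
  H10 D →L[ℝ] ℝ

/-- The space `H^{1/2}(∂D)` of boundary values of `H¹(D)` functions, i.e. the trace space
`H¹(D) / H¹₀(D)`.  (If `D` is a bounded Lipschitz domain, the classical trace operator has kernel
`H¹₀(D)` and identifies this quotient with the space `H^{1/2}(∂D)` of functions on `∂D`; the
quotient makes sense for every open set.) -/
abbrev HHalfBoundary {d : ℕ} (D : Opens (EuclideanSpace ℝ (Fin d))) : Type :=
  H1 D ⧸ H10 D

/-- The trace operator `tr : H¹(D) → H^{1/2}(∂D)`. -/
noncomputable def trace {d : ℕ} (D : Opens (EuclideanSpace ℝ (Fin d))) :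
    H1 D →ₗ[ℝ] HHalfBoundary D :=
  (H10 D).mkQ

/-- `p ∈ H¹(D)` is a weak solution of `-∇·(κ ∇p) = f` in `D`, `p = g` on `∂D`. -/
def IsWeakSolution {d : ℕ} {D : Opens (EuclideanSpace ℝ (Fin d))}
    (κ : EuclideanSpace ℝ (Fin d) → ℝ) (f : HMinus1 D) (g : HHalfBoundary D) (p : H1 D) : Prop :=
  trace D p = g ∧
    ∀ φ : H10 D,
      ∫ x in (D : Set (EuclideanSpace ℝ (Fin d))),
        κ x * inner ℝ (grad p x) (grad (φ : H1 D) x) = f φ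

open Classical in
/-- The construction map `(u, a) ↦ u^a = ∑ᵢ uᵢ 𝟙_{Aᵢ(a)}`, a function on `D` (extended by `0`
outside `D`). The field `u` is a bounded continuous function `D → ℝ^N`, and `A i a` is the `i`-th
region for the geometric parameter `a`. -/
noncomputable def field {d N : ℕ} {D : Opens (EuclideanSpace ℝ (Fin d))} {Λ : Type*}
    (A : Fin N → Λ → Set (EuclideanSpace ℝ (Fin d)))
    (u : D →ᵇ EuclideanSpace ℝ (Fin N)) (a : Λ) : EuclideanSpace ℝ (Fin d) → ℝ :=
  fun x => if hx : x ∈ D then ∑ i, (A i a).indicator (fun _ => u ⟨x, hx⟩ i) x else 0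

/-- The solution map `R(u, a) = p_{u,a}`: the weak solution of
`-∇·(σ(u^a) ∇p) = f` in `D`, `p = g` on `∂D`. -/
noncomputable def solutionMap {d N : ℕ} {D : Opens (EuclideanSpace ℝ (Fin d))} {Λ : Type*}
    (A : Fin N → Λ → Set (EuclideanSpace ℝ (Fin d))) (σ : ℝ → ℝ)
    (f : HMinus1 D) (g : HHalfBoundary D)
    (u : D →ᵇ EuclideanSpace ℝ (Fin N)) (a : Λ) : H1 D :=
  Classical.epsilon (IsWeakSolution (fun x => σ (field A u a x)) f g)

/-- The forward map `G = ℓ ∘ R`. -/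
noncomputable def forwardMap {d N J : ℕ} {D : Opens (EuclideanSpace ℝ (Fin d))} {Λ : Type*}
    (A : Fin N → Λ → Set (EuclideanSpace ℝ (Fin d))) (σ : ℝ → ℝ)
    (f : HMinus1 D) (g : HHalfBoundary D) (ℓ : H1 D →L[ℝ] EuclideanSpace ℝ (Fin J))
    (u : D →ᵇ EuclideanSpace ℝ (Fin N)) (a : Λ) : EuclideanSpace ℝ (Fin J) :=
  ℓ (solutionMap A σ f g u a)

end Darcy

/-! Multiplication by the coefficient `κ = σ(u^a)` is an operator `T` on `L²(D; ℝ^d)`, and the weak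
equation reads `⟨T ∇p, ∇φ⟩ = f φ`. Since `|u^a| ≤ ‖u‖` on `D`, `κ` lies between positive constants
independent of `a`, so `T` is bounded and coercive. Poincaré's inequality makes the form coercive on
`H¹₀(D)`, and Lax–Milgram gives existence.

Everything else rests on one stability estimate, `norm_sub_le_of_variational`: two solutions with
the same data differ by at most `K/m · ‖(κ₁ - κ₂) ∇p₂‖` in `H¹`. Uniqueness is the case `κ₁ = κ₂`.
For varying `u`, the coefficients are close in `L^∞` because `σ` is Lipschitz on bounded intervals;
together with a bound on `p₂` uniform in `a`, this gives the Lipschitz estimate.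

For varying `a` the coefficients need not converge in `L^∞`. They do agree off the sets `A_i(a) Δ
A_i(b)`, whose measure tends to `0`. With `∇p_{u,a}` fixed, absolute continuity of the integral
(`tendsto_norm_mulL_sub`) makes the product small in `L²`. -/

namespace Darcy

/-! ### Variational problems in Hilbert space: stability and Lax–Milgram -/

section Abstract

variable {V L : Type*} [NormedAddCommGroup V] [InnerProductSpace ℝ V]
  [NormedAddCommGroup L] [InnerProductSpace ℝ L]

/-- Two solutions, for two operators `T₁, T₂`, of a variational problem with the same data. -/
theorem norm_sub_le_of_variational {W : Submodule ℝ V} (G : V →L[ℝ] L) {K : ℝ} (hK : 0 ≤ K)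
    (hG : ∀ q ∈ W, ‖q‖ ≤ K * ‖G q‖) {T₁ T₂ : L →L[ℝ] L} {m : ℝ} (hm : 0 < m)
    (hT : ∀ w, m * ‖w‖ ^ 2 ≤ inner ℝ (T₁ w) w) {f : W →L[ℝ] ℝ} {p₁ p₂ : V} (hp : p₁ - p₂ ∈ W)
    (h₁ : ∀ φ : W, inner ℝ (T₁ (G p₁)) (G φ) = f φ)
    (h₂ : ∀ φ : W, inner ℝ (T₂ (G p₂)) (G φ) = f φ) :
    ‖p₁ - p₂‖ ≤ K / m * ‖T₁ (G p₂) - T₂ (G p₂)‖ := by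
  set w := G (p₁ - p₂) with hw
  -- Both equations are tested with `φ = p₁ - p₂`, admissible because the boundary values agree.
  have key : inner ℝ (T₁ w) w = -inner ℝ (T₁ (G p₂) - T₂ (G p₂)) w := by
    have e₁ := h₁ ⟨p₁ - p₂, hp⟩
    have e₂ := h₂ ⟨p₁ - p₂, hp⟩
    simp only [← hw] at e₁ e₂
    have : T₁ w = T₁ (G p₁) - T₁ (G p₂) := by rw [hw, map_sub, map_sub]
    rw [this, inner_sub_left, inner_sub_left, e₁, e₂]
    ring
  have h3 : m * ‖w‖ ^ 2 ≤ ‖T₁ (G p₂) - T₂ (G p₂)‖ * ‖w‖ :=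
    (hT w).trans (by
      rw [key]; exact (neg_le_abs _).trans (abs_real_inner_le_norm _ _))
  have h4 : m * ‖w‖ ≤ ‖T₁ (G p₂) - T₂ (G p₂)‖ := by
    rcases (norm_nonneg w).eq_or_lt with h0 | h0
    · rw [← h0, mul_zero]; exact norm_nonneg _
    · refine le_of_mul_le_mul_right ?_ h0
      linarith [sq ‖w‖]
  calc ‖p₁ - p₂‖ ≤ K * ‖w‖ := hG _ hp
    _ = K / m * (m * ‖w‖) := by field_simp
    _ ≤ _ := by gcongr

/-- Lax–Milgram for a variational problem on a coset of a complete subspace. -/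
theorem existsUnique_variational {W : Submodule ℝ V} [CompleteSpace W] (G : V →L[ℝ] L) {K : ℝ}
    (hK : 0 < K) (hG : ∀ q ∈ W, ‖q‖ ≤ K * ‖G q‖) {T : L →L[ℝ] L} {m : ℝ} (hm : 0 < m)
    (hT : ∀ w, m * ‖w‖ ^ 2 ≤ inner ℝ (T w) w) (f : W →L[ℝ] ℝ) (g : V ⧸ W) :
    ∃! p : V, W.mkQ p = g ∧ ∀ φ : W, inner ℝ (T (G p)) (G φ) = f φ := by
  obtain ⟨p₀, rfl⟩ := W.mkQ_surjective g
  let GW : W →L[ℝ] L := G ∘L W.subtypeL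
  let B : W →L[ℝ] W →L[ℝ] ℝ := (innerSL ℝ).bilinearComp (T ∘L GW) GW
  have hB : ∀ q φ : W, B q φ = inner ℝ (T (G q)) (G φ) := fun q φ => rfl
  have hc : IsCoercive B := by
    refine ⟨m / K ^ 2, by positivity, fun q => ?_⟩
    have h1 := hG q q.2
    have h2 : ‖q‖ * ‖q‖ ≤ K ^ 2 * ‖G q‖ ^ 2 := by
      rw [← mul_pow, ← sq]; exact pow_le_pow_left₀ (norm_nonneg _) h1 2
    calc m / K ^ 2 * ‖q‖ * ‖q‖ = m / K ^ 2 * (‖q‖ * ‖q‖) := by ring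
      _ ≤ m / K ^ 2 * (K ^ 2 * ‖G q‖ ^ 2) := by gcongr
      _ = m * ‖G q‖ ^ 2 := by field_simp
      _ ≤ _ := hT _
  -- With `p = p₀ + q`, the lift `p₀` moves to the right-hand side and `q` solves a problem on `W`.
  let F : W →L[ℝ] ℝ := f - (innerSL ℝ (T (G p₀))) ∘L GW
  let q : W := hc.continuousLinearEquivOfBilin.symm ((InnerProductSpace.toDual ℝ W).symm F)
  have hq : ∀ φ : W, inner ℝ (T (G q)) (G φ) = f φ - inner ℝ (T (G p₀)) (G φ) := by
    intro φ
    rw [← hB, ← hc.continuousLinearEquivOfBilin_apply, ContinuousLinearEquiv.apply_symm_apply,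
      InnerProductSpace.toDual_symm_apply]
    rfl
  refine ⟨p₀ + q, ⟨?_, fun φ => ?_⟩, ?_⟩
  · rw [map_add, add_eq_left]
    simp
  · rw [map_add, map_add, inner_add_left, hq]
    ring
  · rintro p ⟨hp, hpf⟩
    have hmem : p - (p₀ + q) ∈ W := by
      rw [← sub_sub]
      exact W.sub_mem ((Submodule.Quotient.eq W).1 hp) q.2
    -- Uniqueness is stability with equal operators: the right-hand side vanishes.
    have := norm_sub_le_of_variational (f := f) G hK.le hG hm hT (T₂ := T) hmem hpf (fun φ => by
      rw [map_add, map_add, inner_add_left, hq]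
      ring)
    rw [sub_self, norm_zero, mul_zero] at this
    exact sub_eq_zero.1 (norm_le_zero_iff.1 this)

end Abstract

/-! ### Multiplication by bounded coefficients on `L²` -/

section Multiplication

variable {α E : Type*} [MeasurableSpace α] {μ : Measure α}
  [NormedAddCommGroup E] [InnerProductSpace ℝ E]

/-- Multiplication by an `L^∞` function, as an operator on `L²`. -/
noncomputable def mulL (k : Lp ℝ ⊤ μ) : Lp E 2 μ →L[ℝ] Lp E 2 μ :=
  (ContinuousLinearMap.lsmul ℝ ℝ).holderL μ ⊤ 2 2 k

theorem coeFn_mulL (k : Lp ℝ ⊤ μ) (w : Lp E 2 μ) : mulL k w =ᵐ[μ] fun x => k x • w x :=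
  (ContinuousLinearMap.lsmul ℝ ℝ (E := E)).coeFn_holder (r := 2) k w

theorem inner_mulL {k : Lp ℝ ⊤ μ} {κ : α → ℝ} (hk : k =ᵐ[μ] κ) (w z : Lp E 2 μ) :
    inner ℝ (mulL k w) z = ∫ x, κ x * inner ℝ (w x) (z x) ∂μ := by
  rw [L2.inner_def]
  refine integral_congr_ae ?_
  filter_upwards [coeFn_mulL k w, hk] with x h1 h2
  rw [h1, h2, real_inner_smul_left]

theorem le_inner_mulL {k : Lp ℝ ⊤ μ} {m : ℝ} (hk : ∀ᵐ x ∂μ, m ≤ k x) (w : Lp E 2 μ) :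
    m * ‖w‖ ^ 2 ≤ inner ℝ (mulL k w) w := by
  rw [← real_inner_self_eq_norm_sq, L2.inner_def, L2.inner_def, ← integral_const_mul]
  refine integral_mono_ae ((L2.integrable_inner w w).const_mul m) (L2.integrable_inner _ w) ?_
  filter_upwards [coeFn_mulL k w, hk] with x h1 h2
  rw [h1, real_inner_smul_left]
  exact mul_le_mul_of_nonneg_right h2 real_inner_self_nonneg

theorem norm_mulL_sub_le {k₁ k₂ : Lp ℝ ⊤ μ} {c : ℝ} (h : ∀ᵐ x ∂μ, |k₁ x - k₂ x| ≤ c)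
    (w : Lp E 2 μ) : ‖mulL k₁ w - mulL k₂ w‖ ≤ c * ‖w‖ := by
  refine Lp.norm_le_mul_norm_of_ae_le_mul ?_
  filter_upwards [Lp.coeFn_sub (mulL k₁ w) (mulL k₂ w), coeFn_mulL k₁ w, coeFn_mulL k₂ w, h]
    with x h0 h1 h2 h3
  rw [h0, Pi.sub_apply, h1, h2, ← sub_smul, norm_smul]
  exact mul_le_mul_of_nonneg_right h3 (norm_nonneg _)

/-- If bounded multipliers agree with a fixed one outside of small sets, the products converge
in `L²`. -/
theorem tendsto_norm_mulL_sub {ι : Type*} {l : Filter ι} {k : ι → Lp ℝ ⊤ μ} {k₀ : Lp ℝ ⊤ μ}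
    {c : ℝ} {s : ι → Set α} (hs : Tendsto (fun b => μ (s b)) l (𝓝 0))
    (hsm : ∀ b, MeasurableSet (s b))
    (hc : ∀ b, ∀ᵐ x ∂μ, |k b x - k₀ x| ≤ c) (h : ∀ b, ∀ᵐ x ∂μ, x ∉ s b → k b x = k₀ x)
    (w : Lp E 2 μ) : Tendsto (fun b => ‖mulL (k b) w - mulL k₀ w‖) l (𝓝 0) := by
  have hw := L2.integrable_inner (𝕜 := ℝ) w w
  -- Absolute continuity of the integral of the fixed integrable function `c² |w|²`.
  have h1 : Tendsto (fun b => ∫ x in s b, c ^ 2 * inner ℝ (w x) (w x) ∂μ) l (𝓝 0) :=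
    (hw.const_mul (c ^ 2)).tendsto_setIntegral_nhds_zero hs
  have h2 : Tendsto (fun b => ‖mulL (k b) w - mulL k₀ w‖ ^ 2) l (𝓝 0) := by
    refine squeeze_zero (fun _ => sq_nonneg _) (fun b => ?_) h1
    rw [← real_inner_self_eq_norm_sq, L2.inner_def, ← integral_indicator (hsm b)]
    refine integral_mono_ae (L2.integrable_inner _ _) ((hw.const_mul _).indicator (hsm b)) ?_
    filter_upwards [Lp.coeFn_sub (mulL (k b) w) (mulL k₀ w), coeFn_mulL (k b) w, coeFn_mulL k₀ w,
      hc b, h b] with x h0 h1 h2 h3 h4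
    rw [h0, Pi.sub_apply, h1, h2, ← sub_smul, real_inner_smul_left, real_inner_smul_right,
      ← mul_assoc, ← sq]
    by_cases hx : x ∈ s b
    · rw [Set.indicator_of_mem hx]
      refine mul_le_mul_of_nonneg_right ?_ real_inner_self_nonneg
      rw [← sq_abs]
      exact pow_le_pow_left₀ (abs_nonneg _) h3 2
    · rw [Set.indicator_of_notMem hx, h4 hx]
      simp
  simpa using h2.sqrt

end Multiplication

/-! ### Completeness of `H¹` and Poincaré's inequality -/

section Sobolev

variable {d : ℕ} {D : Opens (EuclideanSpace ℝ (Fin d))}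

theorem memLp_fderiv (φ : 𝓓(D, ℝ)) (e : EuclideanSpace ℝ (Fin d)) :
    MemLp (fun x => fderiv ℝ φ x e) 2
      (volume.restrict (D : Set (EuclideanSpace ℝ (Fin d)))) :=
  ((φ.contDiff.continuous_fderiv (by simp)).clm_apply
    continuous_const).memLp_of_hasCompactSupport (φ.hasCompactSupport.fderiv_apply (𝕜 := ℝ) e)

theorem memLp_smul_single (φ : 𝓓(D, ℝ)) (i : Fin d) :
    MemLp (fun x => φ x • EuclideanSpace.single i (1 : ℝ)) 2
      (volume.restrict (D : Set (EuclideanSpace ℝ (Fin d)))) :=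
  (φ.continuous.smul continuous_const).memLp_of_hasCompactSupport φ.hasCompactSupport.smul_right

/-- Pairing with fixed `L²` elements turns the weak gradient condition into equations continuous in
`p`, whence `H¹(D)` is closed. -/
theorem mem_H1_iff (p : L2Pair D) : p ∈ H1 D ↔ ∀ (φ : 𝓓(D, ℝ)) (i : Fin d),
    inner ℝ ((memLp_fderiv φ (EuclideanSpace.single i 1)).toLp _) p.fst =
      -inner ℝ ((memLp_smul_single φ i).toLp _) p.snd := by
  refine forall₂_congr fun φ i => ?_
  rw [L2.inner_def, L2.inner_def]
  refine Eq.congr (integral_congr_ae ?_) (congrArg _ (integral_congr_ae ?_))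
  · filter_upwards [(memLp_fderiv φ (EuclideanSpace.single i 1)).coeFn_toLp] with x hx
    rw [hx]
    simp
  · filter_upwards [(memLp_smul_single φ i).coeFn_toLp] with x hx
    rw [hx, real_inner_smul_left, EuclideanSpace.inner_single_left]
    simp [mul_comm]

theorem isClosed_H1 : IsClosed (H1 D : Set (L2Pair D)) := by
  have : (H1 D : Set (L2Pair D)) = ⋂ (φ : 𝓓(D, ℝ)) (i : Fin d), {p : L2Pair D |
      inner ℝ ((memLp_fderiv φ (EuclideanSpace.single i 1)).toLp _) p.fst =
      -inner ℝ ((memLp_smul_single φ i).toLp _) p.snd} := by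
    ext p
    simpa only [Set.mem_iInter, Set.mem_ofPred_eq] using! mem_H1_iff p
  rw [this]
  refine isClosed_iInter fun φ => isClosed_iInter fun i => isClosed_eq ?_ ?_
  · exact continuous_const.inner (WithLp.continuous_fst _ _ _)
  · exact (continuous_const.inner (WithLp.continuous_snd _ _ _)).neg

instance : CompleteSpace (H1 D) := isClosed_H1.completeSpace_coe

instance : CompleteSpace (H10 D) :=
  (Submodule.isClosed_topologicalClosure _).completeSpace_coe

/-- The weak gradient as a continuous linear map. -/
noncomputable def gradL (D : Opens (EuclideanSpace ℝ (Fin d))) :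
    H1 D →L[ℝ] Lp (EuclideanSpace ℝ (Fin d)) 2
      (volume.restrict (D : Set (EuclideanSpace ℝ (Fin d)))) :=
  WithLp.sndL 2 ℝ _ _ ∘L (H1 D).subtypeL

theorem gradL_apply (p : H1 D) : gradL D p = grad p := rfl

theorem norm_sq_eq (p : H1 D) : ‖p‖ ^ 2 = ‖val p‖ ^ 2 + ‖grad p‖ ^ 2 :=
  WithLp.prod_norm_sq_eq_of_L2 (p : L2Pair D)

theorem continuous_val : Continuous (val (D := D)) :=
  (WithLp.continuous_fst _ _ _).comp continuous_subtype_val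

/-- Bridge to the abstract setting, with `T = mulL k` and `G = gradL D`. -/
theorem isWeakSolution_iff {κ : EuclideanSpace ℝ (Fin d) → ℝ}
    {k : Lp ℝ ⊤ (volume.restrict (D : Set (EuclideanSpace ℝ (Fin d))))}
    (hk : k =ᵐ[volume.restrict (D : Set (EuclideanSpace ℝ (Fin d)))] κ)
    (f : HMinus1 D) (g : HHalfBoundary D) (p : H1 D) :
    IsWeakSolution κ f g p ↔ (H10 D).mkQ p = g ∧
      ∀ φ : H10 D, inner ℝ (mulL k (gradL D p)) (gradL D φ) = f φ := by
  simp only [inner_mulL hk]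
  rfl

/-- The product of a test function with a coordinate function. -/
noncomputable def coordMul (i : Fin d) (φ : 𝓓(D, ℝ)) : 𝓓(D, ℝ) where
  toFun x := x i * φ x
  contDiff' := ContDiff.mul (EuclideanSpace.proj (𝕜 := ℝ) i).contDiff φ.contDiff
  hasCompactSupport' := φ.hasCompactSupport.mul_left
  tsupport_subset' := (tsupport_mul_subset_right).trans φ.tsupport_subset

theorem fderiv_coordMul (i : Fin d) (φ : 𝓓(D, ℝ)) (x : EuclideanSpace ℝ (Fin d)) :
    fderiv ℝ (coordMul i φ) x (EuclideanSpace.single i 1) =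
      φ x + x i * fderiv ℝ φ x (EuclideanSpace.single i 1) := by
  have h1 : HasFDerivAt φ (fderiv ℝ φ x) x :=
    (φ.contDiff.differentiable (by simp) x).hasFDerivAt
  have h2 := (EuclideanSpace.proj (𝕜 := ℝ) i).hasFDerivAt (x := x)
  have h3 := (h2.mul h1).fderiv
  change fderiv ℝ (fun x : EuclideanSpace ℝ (Fin d) => x i * φ x) x _ = _
  erw [h3]
  simp [add_comm]

/-- With `ψ = xᵢ φ`, one has `φ² = φ ∂ᵢψ - ψ ∂ᵢφ`, and integration by parts makes the two terms
contribute equally. Keeping the derivative on `ψ` lets the weak gradient of the class of `φ` be used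
directly, with no need to identify it with `∇φ`. -/
theorem integral_mul_self_eq (i : Fin d) (φ : 𝓓(D, ℝ)) :
    ∫ x, φ x * φ x =
      2 * ∫ x, φ x * fderiv ℝ (coordMul i φ) x (EuclideanSpace.single i 1) := by
  have hφ := φ.continuous
  have hψ := (coordMul i φ).continuous
  have hφ' : Continuous fun x => fderiv ℝ φ x (EuclideanSpace.single i 1) :=
    (φ.contDiff.continuous_fderiv (by simp)).clm_apply continuous_const
  have hψ' : Continuous fun x => fderiv ℝ (coordMul i φ) x (EuclideanSpace.single i 1) :=
    ((coordMul i φ).contDiff.continuous_fderiv (by simp)).clm_apply continuous_const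
  have i1 : Integrable fun x => φ x * fderiv ℝ (coordMul i φ) x (EuclideanSpace.single i 1) :=
    (hφ.mul hψ').integrable_of_hasCompactSupport φ.hasCompactSupport.mul_right
  have i2 : Integrable fun x =>
      fderiv ℝ φ x (EuclideanSpace.single i 1) * coordMul i φ x :=
    (hφ'.mul hψ).integrable_of_hasCompactSupport (coordMul i φ).hasCompactSupport.mul_left
  have i3 : Integrable fun x => φ x * coordMul i φ x :=
    (hφ.mul hψ).integrable_of_hasCompactSupport φ.hasCompactSupport.mul_right
  have key := integral_mul_fderiv_eq_neg_fderiv_mul_of_integrable i2 i1 i3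
    (fun x _ => φ.contDiff.differentiable (by simp) x)
    (fun x _ => (coordMul i φ).contDiff.differentiable (by simp) x)
  have e : (fun x => φ x * φ x) = fun x =>
      φ x * fderiv ℝ (coordMul i φ) x (EuclideanSpace.single i 1) -
        fderiv ℝ φ x (EuclideanSpace.single i 1) * coordMul i φ x := by
    funext x
    rw [fderiv_coordMul]
    change _ = _ - _ * (x i * φ x)
    ring
  rw [e, integral_sub i1 i2]
  linarith

/-- Testing the weak gradient of `v` against `xᵢ φ`, where `v = φ` a.e., gives `‖v‖² = -2 ∫ xᵢ (∇v)ᵢ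
v`; Cauchy–Schwarz and `|xᵢ| ≤ R` finish. -/
theorem norm_val_le_of_mem_testSubspace (i : Fin d) {R : ℝ}
    (hR : ∀ x ∈ D, |x i| ≤ R) {p : H1 D} (hp : p ∈ testSubspace D) :
    ‖val p‖ ≤ 2 * R * ‖grad p‖ := by
  obtain ⟨φ, hφ⟩ := hp
  set μ := volume.restrict (D : Set (EuclideanSpace ℝ (Fin d))) with hμ
  have hzero : ∀ x, x ∉ (D : Set (EuclideanSpace ℝ (Fin d))) → φ x = 0 := fun x hx =>
    image_eq_zero_of_notMem_tsupport fun h => hx (φ.tsupport_subset h)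
  have hD : ∀ᵐ x ∂μ, x ∈ D := ae_restrict_mem D.isOpen.measurableSet
  have hb : ∀ᵐ x ∂μ, ‖x i * grad p x i‖ ≤ R * ‖grad p x‖ := by
    filter_upwards [hD] with x hx
    rw [norm_mul]
    exact mul_le_mul (hR x hx) (PiLp.norm_apply_le _ i) (norm_nonneg _)
      ((abs_nonneg _).trans (hR x hx))
  have hz : MemLp (fun x => x i * grad p x i) 2 μ := by
    refine (Lp.memLp (grad p)).of_le_mul ?_ hb
    exact (EuclideanSpace.proj (𝕜 := ℝ) i).continuous.aestronglyMeasurable.mul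
      ((EuclideanSpace.proj (𝕜 := ℝ) i).continuous.comp_aestronglyMeasurable
        (Lp.memLp (grad p)).1)
  have hzn : ‖hz.toLp _‖ ≤ R * ‖grad p‖ := by
    refine Lp.norm_le_mul_norm_of_ae_le_mul ?_
    filter_upwards [hz.coeFn_toLp, hb] with x h1 h2
    rwa [h1]
  have hweak : ∫ x, val p x * fderiv ℝ (coordMul i φ) x (EuclideanSpace.single i 1) ∂μ =
      -∫ x, grad p x i * coordMul i φ x ∂μ := p.2 (coordMul i φ) i
  have e1 : ‖val p‖ ^ 2 = ∫ x, φ x * φ x := by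
    rw [← setIntegral_eq_integral_of_forall_compl_eq_zero (s := (D : Set _))
        (f := fun x => φ x * φ x) (fun x hx => by rw [hzero x hx, zero_mul]),
      ← real_inner_self_eq_norm_sq, L2.inner_def]
    refine integral_congr_ae ?_
    filter_upwards [hφ] with x hx
    rw [hx]
    rfl
  have e2 : ∫ x, φ x * fderiv ℝ (coordMul i φ) x (EuclideanSpace.single i 1) =
      ∫ x, val p x * fderiv ℝ (coordMul i φ) x (EuclideanSpace.single i 1) ∂μ := by
    rw [← setIntegral_eq_integral_of_forall_compl_eq_zero (s := (D : Set _))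
        (fun x hx => by rw [hzero x hx, zero_mul])]
    refine integral_congr_ae ?_
    filter_upwards [hφ] with x hx
    rw [hx]
  have e3 : ∫ x, grad p x i * coordMul i φ x ∂μ = inner ℝ (hz.toLp _) (val p) := by
    rw [L2.inner_def]
    refine integral_congr_ae ?_
    filter_upwards [hφ, hz.coeFn_toLp] with x hx h2
    rw [hx, h2]
    change _ * (x i * φ x) = φ x * _
    simp
    ring
  have h4 : ‖val p‖ ^ 2 ≤ 2 * R * ‖grad p‖ * ‖val p‖ := by
    rw [e1, integral_mul_self_eq i, e2, hweak, e3]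
    have := (neg_le_abs _).trans (abs_real_inner_le_norm (hz.toLp _) (val p))
    have := mul_le_mul_of_nonneg_right hzn (norm_nonneg (val p))
    linarith
  rcases (norm_nonneg (val p)).eq_or_lt with h0 | h0
  · rw [← h0, e1] at *
    -- If `D` is empty, `R` may be negative, so `0 ≤ R * ‖grad p‖` is read off `hzn`.
    have := (norm_nonneg _).trans hzn
    linarith
  · refine le_of_mul_le_mul_right ?_ h0
    rwa [← sq]

/-- Poincaré's inequality on `H¹₀(D)`. -/
theorem exists_norm_le_norm_gradL (hd : 1 ≤ d)
    (hD : Bornology.IsBounded (D : Set (EuclideanSpace ℝ (Fin d)))) :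
    ∃ K : ℝ, 0 < K ∧ ∀ p ∈ H10 D, ‖p‖ ≤ K * ‖gradL D p‖ := by
  obtain ⟨R, hR0, hR⟩ := hD.exists_pos_norm_le
  -- The full norm satisfies `‖p‖² ≤ (4R² + 1) ‖∇p‖² ≤ (2R + 1)² ‖∇p‖²`.
  refine ⟨2 * R + 1, by linarith, fun p hp => ?_⟩
  have hv : ‖val p‖ ≤ 2 * R * ‖grad p‖ := by
    have hcl : IsClosed {p : H1 D | ‖val p‖ ≤ 2 * R * ‖gradL D p‖} :=
      isClosed_le continuous_val.norm (continuous_const.mul (gradL D).continuous.norm)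
    exact closure_minimal (fun q hq => norm_val_le_of_mem_testSubspace ⟨0, hd⟩
      (fun x hx => (PiLp.norm_apply_le x _).trans (hR x hx)) hq) hcl hp
  rw [gradL_apply]
  refine le_of_sq_le_sq ?_ (by positivity)
  rw [norm_sq_eq]
  nlinarith [norm_nonneg (val p), norm_nonneg (grad p),
    pow_le_pow_left₀ (norm_nonneg (val p)) hv 2, mul_nonneg hR0.le (sq_nonneg ‖grad p‖)]

end Sobolev

end Darcy
namespace Darcy

/-! ### Well-posedness and stability of the elliptic problem -/

section WeakSolution

variable {d : ℕ} {D : Opens (EuclideanSpace ℝ (Fin d))}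
  {f : HMinus1 D} {g : HHalfBoundary D}

/-- The class in `L^∞(D)` of a bounded coefficient. -/
theorem exists_coeff {κ : EuclideanSpace ℝ (Fin d) → ℝ}
    (hκ : AEStronglyMeasurable κ (volume.restrict (D : Set (EuclideanSpace ℝ (Fin d)))))
    {M : ℝ} (hM : ∀ x ∈ D, |κ x| ≤ M) :
    ∃ k : Lp ℝ ⊤ (volume.restrict (D : Set (EuclideanSpace ℝ (Fin d)))),
      k =ᵐ[volume.restrict (D : Set (EuclideanSpace ℝ (Fin d)))] κ := by
  have h : MemLp κ ⊤ (volume.restrict (D : Set (EuclideanSpace ℝ (Fin d)))) :=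
    memLp_top_of_bound hκ M
      ((ae_restrict_mem D.isOpen.measurableSet).mono fun x hx => hM x hx)
  exact ⟨h.toLp κ, h.coeFn_toLp⟩

theorem ae_le_coeff {κ : EuclideanSpace ℝ (Fin d) → ℝ}
    {k : Lp ℝ ⊤ (volume.restrict (D : Set (EuclideanSpace ℝ (Fin d))))}
    (hk : k =ᵐ[volume.restrict (D : Set (EuclideanSpace ℝ (Fin d)))] κ) {m : ℝ}
    (hm : ∀ x ∈ D, m ≤ κ x) :
    ∀ᵐ x ∂volume.restrict (D : Set (EuclideanSpace ℝ (Fin d))), m ≤ k x := by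
  filter_upwards [hk, ae_restrict_mem D.isOpen.measurableSet] with x hx hxD
  rw [hx]
  exact hm x hxD

theorem ae_abs_coeff_sub_le {κ₁ κ₂ : EuclideanSpace ℝ (Fin d) → ℝ}
    {k₁ k₂ : Lp ℝ ⊤ (volume.restrict (D : Set (EuclideanSpace ℝ (Fin d))))}
    (hk₁ : k₁ =ᵐ[volume.restrict (D : Set (EuclideanSpace ℝ (Fin d)))] κ₁)
    (hk₂ : k₂ =ᵐ[volume.restrict (D : Set (EuclideanSpace ℝ (Fin d)))] κ₂) {c : ℝ}
    (hc : ∀ x ∈ D, |κ₁ x - κ₂ x| ≤ c) :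
    ∀ᵐ x ∂volume.restrict (D : Set (EuclideanSpace ℝ (Fin d))), |k₁ x - k₂ x| ≤ c := by
  filter_upwards [hk₁, hk₂, ae_restrict_mem D.isOpen.measurableSet] with x h1 h2 hxD
  rw [h1, h2]
  exact hc x hxD

theorem existsUnique_isWeakSolution {K : ℝ} (hK : 0 < K)
    (hP : ∀ p ∈ H10 D, ‖p‖ ≤ K * ‖gradL D p‖) {κ : EuclideanSpace ℝ (Fin d) → ℝ}
    {k : Lp ℝ ⊤ (volume.restrict (D : Set (EuclideanSpace ℝ (Fin d))))}
    (hk : k =ᵐ[volume.restrict (D : Set (EuclideanSpace ℝ (Fin d)))] κ) {m : ℝ} (hm : 0 < m)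
    (hκ : ∀ x ∈ D, m ≤ κ x) (f : HMinus1 D) (g : HHalfBoundary D) :
    ∃! p, IsWeakSolution κ f g p := by
  simp only [isWeakSolution_iff hk]
  exact existsUnique_variational (gradL D) hK hP hm (le_inner_mulL (ae_le_coeff hk hκ)) f g

/-- Stability of weak solutions under perturbations of the coefficient. -/
theorem IsWeakSolution.norm_sub_le {K : ℝ} (hK : 0 ≤ K)
    (hP : ∀ p ∈ H10 D, ‖p‖ ≤ K * ‖gradL D p‖) {κ₁ κ₂ : EuclideanSpace ℝ (Fin d) → ℝ}
    {k₁ k₂ : Lp ℝ ⊤ (volume.restrict (D : Set (EuclideanSpace ℝ (Fin d))))}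
    (hk₁ : k₁ =ᵐ[volume.restrict (D : Set (EuclideanSpace ℝ (Fin d)))] κ₁)
    (hk₂ : k₂ =ᵐ[volume.restrict (D : Set (EuclideanSpace ℝ (Fin d)))] κ₂) {m : ℝ} (hm : 0 < m)
    (hκ : ∀ x ∈ D, m ≤ κ₁ x) {p₁ p₂ : H1 D}
    (h₁ : IsWeakSolution κ₁ f g p₁) (h₂ : IsWeakSolution κ₂ f g p₂) :
    ‖p₁ - p₂‖ ≤ K / m * ‖mulL k₁ (gradL D p₂) - mulL k₂ (gradL D p₂)‖ := by
  rw [isWeakSolution_iff hk₁] at h₁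
  rw [isWeakSolution_iff hk₂] at h₂
  exact norm_sub_le_of_variational (gradL D) hK hP hm (le_inner_mulL (ae_le_coeff hk₁ hκ))
    ((Submodule.Quotient.eq _).1 (h₁.1.trans h₂.1.symm)) h₁.2 h₂.2

theorem IsWeakSolution.norm_sub_le_of_abs_sub_le {K : ℝ} (hK : 0 ≤ K)
    (hP : ∀ p ∈ H10 D, ‖p‖ ≤ K * ‖gradL D p‖) {κ₁ κ₂ : EuclideanSpace ℝ (Fin d) → ℝ}
    {k₁ k₂ : Lp ℝ ⊤ (volume.restrict (D : Set (EuclideanSpace ℝ (Fin d))))}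
    (hk₁ : k₁ =ᵐ[volume.restrict (D : Set (EuclideanSpace ℝ (Fin d)))] κ₁)
    (hk₂ : k₂ =ᵐ[volume.restrict (D : Set (EuclideanSpace ℝ (Fin d)))] κ₂) {m : ℝ} (hm : 0 < m)
    (hκ : ∀ x ∈ D, m ≤ κ₁ x) {c : ℝ} (hc₀ : 0 ≤ c) (hc : ∀ x ∈ D, |κ₁ x - κ₂ x| ≤ c)
    {p₁ p₂ : H1 D} (h₁ : IsWeakSolution κ₁ f g p₁) (h₂ : IsWeakSolution κ₂ f g p₂) :
    ‖p₁ - p₂‖ ≤ K / m * (c * ‖p₂‖) := by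
  refine (h₁.norm_sub_le hK hP hk₁ hk₂ hm hκ h₂).trans ?_
  have hg : ‖gradL D p₂‖ ≤ ‖p₂‖ := by
    refine le_of_sq_le_sq ?_ (norm_nonneg _)
    rw [norm_sq_eq, gradL_apply]
    exact le_add_of_nonneg_left (sq_nonneg _)
  have := norm_mulL_sub_le (ae_abs_coeff_sub_le hk₁ hk₂ hc) (gradL D p₂)
  gcongr
  exact this.trans (by gcongr)

end WeakSolution

/-! ### The piecewise field `u^a` -/

section Field

variable {d N : ℕ} {D : Opens (EuclideanSpace ℝ (Fin d))} {Λ : Type*}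
  {A : Fin N → Λ → Set (EuclideanSpace ℝ (Fin d))}

theorem field_of_mem {a : Λ} (hA : ∀ i j, i ≠ j → A i a ∩ A j a = ∅)
    (u : D →ᵇ EuclideanSpace ℝ (Fin N)) {x : EuclideanSpace ℝ (Fin d)} (hx : x ∈ D)
    {i : Fin N} (hi : x ∈ A i a) : field A u a x = u ⟨x, hx⟩ i := by
  rw [field, dif_pos hx, Finset.sum_eq_single i, Set.indicator_of_mem hi]
  · intro j _ hj
    exact Set.indicator_of_notMem (fun h => (hA j i hj).subset ⟨h, hi⟩) _
  · simp

variable (hA_union : ∀ a, ⋃ i, A i a = (D : Set (EuclideanSpace ℝ (Fin d))))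
  (hA_disj : ∀ a i j, i ≠ j → A i a ∩ A j a = ∅)

include hA_union hA_disj

theorem abs_field_le (u : D →ᵇ EuclideanSpace ℝ (Fin N)) (a : Λ)
    {x : EuclideanSpace ℝ (Fin d)} (hx : x ∈ D) : |field A u a x| ≤ ‖u‖ := by
  obtain ⟨i, hi⟩ := Set.mem_iUnion.1 ((hA_union a).symm.subset hx)
  rw [field_of_mem (hA_disj a) u hx hi]
  exact (PiLp.norm_apply_le _ i).trans (u.norm_coe_le_norm _)

theorem abs_field_sub_le (u v : D →ᵇ EuclideanSpace ℝ (Fin N)) (a : Λ)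
    {x : EuclideanSpace ℝ (Fin d)} (hx : x ∈ D) :
    |field A u a x - field A v a x| ≤ ‖u - v‖ := by
  obtain ⟨i, hi⟩ := Set.mem_iUnion.1 ((hA_union a).symm.subset hx)
  rw [field_of_mem (hA_disj a) u hx hi, field_of_mem (hA_disj a) v hx hi]
  exact (PiLp.norm_apply_le ((u - v) ⟨x, hx⟩) i).trans ((u - v).norm_coe_le_norm _)

theorem field_eq_of_notMem_symmDiff (u : D →ᵇ EuclideanSpace ℝ (Fin N)) {a b : Λ}
    {x : EuclideanSpace ℝ (Fin d)} (hx : x ∈ D) (h : x ∉ ⋃ i, symmDiff (A i a) (A i b)) :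
    field A u b x = field A u a x := by
  obtain ⟨i, hi⟩ := Set.mem_iUnion.1 ((hA_union a).symm.subset hx)
  have hib : x ∈ A i b := by
    by_contra hib
    exact h (Set.mem_iUnion.2 ⟨i, Or.inl ⟨hi, hib⟩⟩)
  rw [field_of_mem (hA_disj a) u hx hi, field_of_mem (hA_disj b) u hx hib]

omit hA_union hA_disj

theorem aemeasurable_field (hA_meas : ∀ i a, MeasurableSet (A i a))
    (u : D →ᵇ EuclideanSpace ℝ (Fin N)) (a : Λ) :
    AEMeasurable (field A u a) (volume.restrict (D : Set (EuclideanSpace ℝ (Fin d)))) := by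
  refine aemeasurable_restrict_of_measurable_subtype D.isOpen.measurableSet ?_
  have e : (fun x : (D : Set (EuclideanSpace ℝ (Fin d))) => field A u a x) =
      fun x => ∑ i, (Subtype.val ⁻¹' A i a).indicator (fun y : D => u y i) x := by
    funext x
    rw [field, dif_pos (show (x : EuclideanSpace ℝ (Fin d)) ∈ D from x.2)]
    rfl
  rw [e]
  refine Finset.measurable_fun_sum _ fun i _ => Measurable.indicator ?_ ?_
  · exact ((EuclideanSpace.proj (𝕜 := ℝ) i).continuous.comp u.continuous).measurable
  · exact measurable_subtype_coe (hA_meas i a)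

end Field

/-- Bounds for a positive `C¹` function on a bounded interval. -/
theorem exists_bounds {σ : ℝ → ℝ} (hσ : ContDiff ℝ 1 σ) (hpos : ∀ t, 0 < σ t) (r : ℝ) :
    ∃ m M c : ℝ, 0 < m ∧ 0 ≤ M ∧ 0 ≤ c ∧ (∀ t, |t| ≤ r → m ≤ σ t ∧ |σ t| ≤ M) ∧
      ∀ s t, |s| ≤ r → |t| ≤ r → |σ s - σ t| ≤ c * |s - t| := by
  have hmem : ∀ t, |t| ≤ r → t ∈ Set.Icc (-r) r := fun t ht => abs_le.1 ht
  obtain ⟨M, hM⟩ := isCompact_Icc.exists_bound_of_continuousOn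
    (hσ.continuous.continuousOn (s := Set.Icc (-r) r))
  obtain ⟨W, hW⟩ := isCompact_Icc.exists_bound_of_continuousOn
    ((hσ.continuous.inv₀ fun t => (hpos t).ne').continuousOn (s := Set.Icc (-r) r))
  obtain ⟨c, hc⟩ := hσ.locallyLipschitz.locallyLipschitzOn.exists_lipschitzOnWith_of_compact
    (isCompact_Icc (a := -r) (b := r))
  -- `W` bounds `1/σ`, so `1/W` would bound `σ` below; the maxima keep the signs right even when `r
  -- < 0` and the interval is empty.
  refine ⟨(max W 1)⁻¹, max M 0, c, by positivity, le_max_right _ _, c.2, fun t ht => ⟨?_, ?_⟩,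
    fun s t hs ht => ?_⟩
  · refine inv_le_of_inv_le₀ (hpos t) (le_max_of_le_left ?_)
    exact (le_abs_self _).trans (hW t (hmem t ht))
  · exact le_max_of_le_left (hM t (hmem t ht))
  · simpa only [Real.dist_eq] using hc.dist_le_mul s (hmem s hs) t (hmem t ht)

end Darcy

/-! ### The forward map -/

open Darcy in
theorem mainTheorem6 {d k N J : ℕ} (hd : 1 ≤ d)
    -- the domain: a bounded open subset of `ℝ^d`
    (D : TopologicalSpace.Opens (EuclideanSpace ℝ (Fin d)))
    (hD : Bornology.IsBounded (D : Set (EuclideanSpace ℝ (Fin d))))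
    -- the parameter set `Λ ⊆ ℝ^k` and the regions `A_i(a)`: Borel, partitioning `D`, continuous in `a`
    (Λ : Set (EuclideanSpace ℝ (Fin k)))
    (A : Fin N → Λ → Set (EuclideanSpace ℝ (Fin d)))
    (hA_meas : ∀ i a, MeasurableSet (A i a))
    (hA_union : ∀ a, ⋃ i, A i a = (D : Set (EuclideanSpace ℝ (Fin d))))
    (hA_disj : ∀ a i j, i ≠ j → A i a ∩ A j a = ∅)
    (hA_cont : ∀ i a, Filter.Tendsto
      (fun b => MeasureTheory.volume (symmDiff (A i a) (A i b))) (nhds a) (nhds 0))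
    -- the positive continuously differentiable map `σ`
    (σ : ℝ → ℝ) (hσ : ContDiff ℝ 1 σ) (hσ_pos : ∀ t, 0 < σ t)
    -- source, boundary value, observation operator
    (f : Darcy.HMinus1 D) (g : Darcy.HHalfBoundary D)
    (ℓ : Darcy.H1 D →L[ℝ] EuclideanSpace ℝ (Fin J)) :
    -- the forward map is well defined
    (∀ (u : BoundedContinuousFunction D (EuclideanSpace ℝ (Fin N))) (a : Λ),
      ∃! p : Darcy.H1 D, Darcy.IsWeakSolution (fun x => σ (Darcy.field A u a x)) f g p) ∧
    -- it is locally Lipschitz in `u`, uniformly in `a`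
    (∀ r : ℝ, 0 < r → ∃ C : ℝ, 0 < C ∧
      ∀ u v : BoundedContinuousFunction D (EuclideanSpace ℝ (Fin N)), ‖u‖ < r → ‖v‖ < r →
        ∀ a : Λ, ‖Darcy.forwardMap A σ f g ℓ u a - Darcy.forwardMap A σ f g ℓ v a‖
          ≤ C * ‖u - v‖) ∧
    -- it is continuous in `a`
    (∀ u : BoundedContinuousFunction D (EuclideanSpace ℝ (Fin N)),
      Continuous (fun a : Λ => Darcy.forwardMap A σ f g ℓ u a)) := by

  obtain ⟨K, hK, hP⟩ := exists_norm_le_norm_gradL hd hD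
  have coeff : ∀ (u : BoundedContinuousFunction D (EuclideanSpace ℝ (Fin N))) (a : Λ),
      ∃ k : Lp ℝ ⊤ (volume.restrict (D : Set (EuclideanSpace ℝ (Fin d)))),
        k =ᵐ[volume.restrict (D : Set (EuclideanSpace ℝ (Fin d)))]
          fun x => σ (field A u a x) := by
    intro u a
    obtain ⟨m, M, c, -, -, -, hb, -⟩ := exists_bounds hσ hσ_pos ‖u‖
    exact exists_coeff
      (hσ.continuous.comp_aestronglyMeasurable
        (aemeasurable_field hA_meas u a).aestronglyMeasurable)
      fun x hx => (hb _ (abs_field_le hA_union hA_disj u a hx)).2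
  have exu : ∀ (u : BoundedContinuousFunction D (EuclideanSpace ℝ (Fin N))) (a : Λ),
      ∃! p : H1 D, IsWeakSolution (fun x => σ (field A u a x)) f g p := by
    intro u a
    obtain ⟨m, M, c, hm, -, -, hb, -⟩ := exists_bounds hσ hσ_pos ‖u‖
    obtain ⟨k, hk⟩ := coeff u a
    exact existsUnique_isWeakSolution hK hP hk hm
      (fun x hx => (hb _ (abs_field_le hA_union hA_disj u a hx)).1) f g
  have sol : ∀ (u : BoundedContinuousFunction D (EuclideanSpace ℝ (Fin N))) (a : Λ),
      IsWeakSolution (fun x => σ (field A u a x)) f g (solutionMap A σ f g u a) :=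
    fun u a => Classical.epsilon_spec (exu u a).exists
  refine ⟨exu, fun r hr => ?_, fun u => ?_⟩
  · obtain ⟨m, M, c, hm, hM, hc, hb, hl⟩ := exists_bounds hσ hσ_pos r
    -- The solution `p₁` for the coefficient `1` serves as reference: stability against it, with
    -- `|σ(v^a) - 1| ≤ M + 1`, bounds all `p_{v,a}` with `‖v‖ < r` uniformly in `a`.
    obtain ⟨k₁, hk₁⟩ := exists_coeff (D := D) (κ := fun _ => 1) aestronglyMeasurable_const
      (M := 1) (fun x _ => by simp)
    obtain ⟨p₁, hp₁, -⟩ := existsUnique_isWeakSolution hK hP hk₁ one_pos (fun _ _ => le_rfl) f g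
    let P : ℝ := ‖p₁‖ + K / m * ((M + 1) * ‖p₁‖)
    have hP0 : 0 ≤ P := by positivity
    have bound : ∀ v : BoundedContinuousFunction D (EuclideanSpace ℝ (Fin N)), ‖v‖ < r →
        ∀ a : Λ, ‖solutionMap A σ f g v a‖ ≤ P := by
      intro v hv a
      obtain ⟨k, hk⟩ := coeff v a
      have hf : ∀ x ∈ D, |field A v a x| ≤ r := fun x hx =>
        (abs_field_le hA_union hA_disj v a hx).trans hv.le
      have h := (sol v a).norm_sub_le_of_abs_sub_le hK.le hP hk hk₁ hm
        (fun x hx => (hb _ (hf x hx)).1) (c := M + 1) (by positivity)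
        (fun x hx => (abs_sub _ _).trans (by simpa using (hb _ (hf x hx)).2)) hp₁
      have := norm_le_norm_add_norm_sub' (solutionMap A σ f g v a) p₁
      linarith
    -- The `+ 1` only makes the constant strictly positive.
    refine ⟨‖ℓ‖ * (K / m * (c * P)) + 1, by positivity, fun u v hu hv a => ?_⟩
    obtain ⟨ku, hku⟩ := coeff u a
    obtain ⟨kv, hkv⟩ := coeff v a
    have hfu : ∀ x ∈ D, |field A u a x| ≤ r := fun x hx =>
      (abs_field_le hA_union hA_disj u a hx).trans hu.le
    have hfv : ∀ x ∈ D, |field A v a x| ≤ r := fun x hx =>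
      (abs_field_le hA_union hA_disj v a hx).trans hv.le
    have h := (sol u a).norm_sub_le_of_abs_sub_le hK.le hP hku hkv hm
      (fun x hx => (hb _ (hfu x hx)).1) (c := c * ‖u - v‖) (by positivity)
      (fun x hx => (hl _ _ (hfu x hx) (hfv x hx)).trans
        (mul_le_mul_of_nonneg_left (abs_field_sub_le hA_union hA_disj u v a hx) hc)) (sol v a)
    have h' := bound v hv a
    calc ‖forwardMap A σ f g ℓ u a - forwardMap A σ f g ℓ v a‖
        = ‖ℓ (solutionMap A σ f g u a - solutionMap A σ f g v a)‖ := by rw [map_sub]; rfl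
      _ ≤ ‖ℓ‖ * (K / m * (c * ‖u - v‖ * P)) :=
        (ℓ.le_opNorm _).trans (by gcongr; exact h.trans (by gcongr))
      _ = ‖ℓ‖ * (K / m * (c * P)) * ‖u - v‖ := by ring
      _ ≤ _ := by gcongr; linarith
  · refine ℓ.continuous.comp (continuous_iff_continuousAt.2 fun a => ?_)
    obtain ⟨m, M, c, hm, hM, -, hb, -⟩ := exists_bounds hσ hσ_pos ‖u‖
    choose k hk using coeff u
    have hf : ∀ b, ∀ x ∈ D, |field A u b x| ≤ ‖u‖ := fun b x hx =>
      abs_field_le hA_union hA_disj u b hx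
    have hs : Tendsto (fun b => volume.restrict (D : Set (EuclideanSpace ℝ (Fin d)))
        (⋃ i, symmDiff (A i a) (A i b))) (𝓝 a) (𝓝 0) := by
      have h0 : Tendsto (fun b => ∑ i, volume (symmDiff (A i a) (A i b))) (𝓝 a) (𝓝 0) := by
        simpa using tendsto_finsetSum Finset.univ fun i _ => hA_cont i a
      refine tendsto_of_tendsto_of_tendsto_of_le_of_le tendsto_const_nhds h0
        (fun _ => zero_le) fun b => ?_
      refine (Measure.restrict_apply_le _ _).trans ((measure_iUnion_le _).trans ?_)
      rw [tsum_fintype]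
    have h := tendsto_norm_mulL_sub (k := k) (k₀ := k a) (c := M + M) hs
      (fun b => MeasurableSet.iUnion fun i => (hA_meas i a).symmDiff (hA_meas i b))
      (fun b => ae_abs_coeff_sub_le (hk b) (hk a) fun x hx =>
        (abs_sub _ _).trans (add_le_add (hb _ (hf b x hx)).2 (hb _ (hf a x hx)).2))
      (fun b => by
        filter_upwards [hk b, hk a, ae_restrict_mem D.isOpen.measurableSet] with x h1 h2 hx hs
        rw [h1, h2, field_eq_of_notMem_symmDiff hA_union hA_disj u hx hs])
      (gradL D (solutionMap A σ f g u a))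
    refine tendsto_iff_norm_sub_tendsto_zero.2
      (squeeze_zero (fun _ => norm_nonneg _) (fun b => ?_) (by simpa using h.const_mul (K / m)))
    -- The order matters: the lower bound `m` on the moving coefficient is uniform in `b`, while the
    -- gradient in the error term is that of the fixed solution at `a`.
    exact (sol u b).norm_sub_le hK.le hP (hk b) (hk a) hm (fun x hx => (hb _ (hf b x hx)).1)
      (sol u a)
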